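/- Let $G$ be a (discrete) group, let $\mathcal{F}$ be a family of finite subgroups of $G$ that is closed under conjugation and under taking subgroups, and let $R$ be a nonzero commutative ring with unit. The orbit category $\mathcal{O}_{\mathcal{F}}$ has as objects the $G$-sets $G/H$ with $H\in\mathcal{F}$, and the morphisms from $G/H$ to $G/K$ form the free abelian group on the $G$-maps $G/H\to G/K$. The Mackey category $\mathcal{M}_{\mathcal{F}}$ has the same objects; the morphisms from $G/H$ to $G/K$ form the free abelian group on the equivalence classes of diagrams of $G$-maps $G/H\leftarrow G/L\to G/K$ with $L\in\mathcal{F}$ (two diagrams being equivalent if a bijective $G$-map of the middle terms commutes with the legs). Composition in $\mathcal{M}_{\mathcal{F}}$ is biadditive and is given on such diagrams by the pullback of $G$-sets, written as the sum of its orbits. For $\mathfrak{C}$ one of these categories, a $\mathfrak{C}$-module is a contravariant additive functor from $\mathfrak{C}$ to $R$-modules; the free $\mathfrak{C}$-modules are the direct sums $\bigoplus_{i\in I}R[-,x_i]_{\mathfrak{C}}$, where $R[y,x]_{\mathfrak{C}}=R\otimes_{\mathbb{Z}}\operatorname{Hom}_{\mathfrak{C}}(y,x)$; the projective modules are the direct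 summands of free modules; and a module is finitely generated if it is a quotient of a free module with $I$ finite. A $\mathfrak{C}$-module is of type $\mathrm{FP}_n$ if it has a projective resolution that is finitely generated in degrees $\le n$. The group $G$ is of type $\mathcal{O}_{\mathcal{F}}\mathrm{FP}_n$ if the constant $\mathcal{O}_{\mathcal{F}}$-module $\underline{R}$ (every $G$-map acting as the identity of $R$) is of type $\mathrm{FP}_n$, and of type $\mathcal{M}_{\mathcal{F}}\mathrm{FP}_n$ if the Burnside functor $B^G$ is of type $\mathrm{FP}_n$. Here $B^G$ is the $\mathcal{M}_{\mathcal{F}}$-module sending $G/H$ to $R\otimes_{\mathbb{Z}}-$ of the free abelian group on the equivalence classes of diagrams $G/H\leftarrow G/L\to G/G$ with $L\in\mathcal{F}$, on which $\mathcal{M}_{\mathcal{F}}$ acts by composition. Then $G$ is of type $\mathcal{M}_{\mathcal{F}}\mathrm{FP}_0$ over $R$ if and only if the poset $\mathcal{F}/G$ of conjugacy classes of subgroups in $\mathcal{F}$, ordered by subconjugation, is finite. Moreover $G$ is of type $\mathcal{O}_{\mathcal{F}}\mathrm{FP}_0$ over $R$ if and only if it is of type $\mathcal{M}_{\mathcal{F}}\mathrm{FP}_0$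 over $R$. -/

import Mathlib

open CategoryTheory Opposite
open scoped TensorProduct

universe u v

noncomputable section

/-! ## Modules over a small preadditive category, finite generation and `FP_n` -/

section CatModules

variable (R : Type v) [CommRing R] (C : Type u) [SmallCategory C] [Preadditive C]

/-- Contravariant `C`-modules over `R`: additive functors `Cᵒᵖ ⥤ R-Mod`. -/
abbrev CatModule := Cᵒᵖ ⥤+ ModuleCat.{max u v} R

variable {C}

/-- The free `C`-module `⨁ i, R[-, x i]`, where `R[y, x] = R ⊗[ℤ] (y ⟶ x)`. -/
def CatModule.free {I : Type (max u v)} (x : I → C) : CatModule R C where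
  obj :=
    { obj := fun y => ModuleCat.of R (DirectSum I fun i => R ⊗[ℤ] (y.unop ⟶ x i))
      map := fun {y z} f => ModuleCat.ofHom (DirectSum.lmap fun i =>
        LinearMap.baseChange R (Preadditive.leftComp (x i) f.unop).toIntLinearMap)
      map_id := fun y => by
        have h : ∀ i, LinearMap.baseChange R
            (Preadditive.leftComp (x i) (𝟙 y.unop)).toIntLinearMap
            = LinearMap.id := fun i => by
          ext a
          exact congrArg (fun t => (1 : R) ⊗ₜ[ℤ] t) (Category.id_comp a)
        ext1
        simp only [unop_id, h, ModuleCat.hom_ofHom, ModuleCat.hom_id]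
        exact DirectSum.lmap_id
      map_comp := fun {y z w} f g => by
        have h : ∀ i, LinearMap.baseChange R
            (Preadditive.leftComp (x i) (g.unop ≫ f.unop)).toIntLinearMap
            = (LinearMap.baseChange R (Preadditive.leftComp (x i) g.unop).toIntLinearMap).comp
              (LinearMap.baseChange R (Preadditive.leftComp (x i) f.unop).toIntLinearMap) :=
            fun i => by
          ext a
          exact congrArg (fun t => (1 : R) ⊗ₜ[ℤ] t) (Category.assoc g.unop f.unop a)
        ext1
        simp only [unop_comp, h, ModuleCat.hom_ofHom, ModuleCat.hom_comp]
        exact DirectSum.lmap_comp _ _ }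
  property := by
    refine ⟨fun {y z f g} => ?_⟩
    have h : ∀ i, LinearMap.baseChange R
        (Preadditive.leftComp (x i) (f.unop + g.unop)).toIntLinearMap
        = LinearMap.baseChange R (Preadditive.leftComp (x i) f.unop).toIntLinearMap +
          LinearMap.baseChange R (Preadditive.leftComp (x i) g.unop).toIntLinearMap :=
        fun i => by
      ext a
      exact (congrArg (fun t => (1 : R) ⊗ₜ[ℤ] t)
        (Preadditive.add_comp _ _ _ f.unop g.unop a)).trans (TensorProduct.tmul_add _ _ _)
    ext1
    simp only [unop_add, h, ModuleCat.hom_ofHom, ModuleCat.hom_add]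
    ext a i
    simp

variable {R}

/-- A `C`-module is projective if it is a direct summand of a free module. -/
def CatModule.IsProj (P : CatModule R C) : Prop :=
  ∃ (I : Type (max u v)) (x : I → C), Nonempty (Retract P (CatModule.free R x))

/-- A `C`-module is finitely generated if it receives an epimorphism (that is, a pointwise
surjection) from a free module on finitely many generators. -/
def CatModule.IsFG (M : CatModule R C) : Prop :=
  ∃ (I : Type (max u v)) (_ : Finite I) (x : I → C) (f : CatModule.free R x ⟶ M),
    ∀ y, Function.Surjective (f.hom.app y).hom

/-- `M` is of type `FP_n`: it has a resolution `⋯ ⟶ P 1 ⟶ P 0 ⟶ M ⟶ 0` by projective modules,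
with `P i` finitely generated for `i ≤ n`. Exactness is evaluated at each object. -/
def CatModule.IsFP (M : CatModule R C) (n : ℕ) : Prop :=
  ∃ (P : ℕ → CatModule R C) (d : ∀ i, P (i + 1) ⟶ P i) (ε : P 0 ⟶ M),
    (∀ i, (P i).IsProj) ∧
    (∀ y, Function.Surjective (ε.hom.app y).hom) ∧
    (∀ y, Function.Exact ((d 0).hom.app y).hom (ε.hom.app y).hom) ∧
    (∀ i y, Function.Exact ((d (i + 1)).hom.app y).hom ((d i).hom.app y).hom) ∧
    (∀ i ≤ n, (P i).IsFG)

end CatModules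

/-! ## Families of finite subgroups -/

/-- A family of finite subgroups of `G`, closed under conjugation and passage to subgroups. -/
structure FinSubgroupFamily (G : Type u) [Group G] where
  carrier : Set (Subgroup G)
  finite : ∀ H ∈ carrier, Finite H
  conj_mem : ∀ H ∈ carrier, ∀ g : G, H.map (MulAut.conj g).toMonoidHom ∈ carrier
  le_mem : ∀ H ∈ carrier, ∀ K : Subgroup G, K ≤ H → K ∈ carrier

namespace FinSubgroupFamily

variable {G : Type u} [Group G] (𝓕 : FinSubgroupFamily G)

/-- Conjugacy in `G` of members of the family. -/
def conjSetoid : Setoid 𝓕.carrier where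
  r H K := ∃ g : G, K.1 = H.1.map (MulAut.conj g).toMonoidHom
  iseqv :=
    { refl := fun H => ⟨1, by ext; simp⟩
      symm := by
        rintro H K ⟨g, hg⟩
        refine ⟨g⁻¹, ?_⟩
        rw [hg, Subgroup.map_map]
        have : (MulAut.conj g⁻¹).toMonoidHom.comp (MulAut.conj g).toMonoidHom = MonoidHom.id G := by
          ext x; simp [mul_assoc]
        rw [this, Subgroup.map_id]
      trans := by
        rintro H K L ⟨g, hg⟩ ⟨k, hk⟩
        exact ⟨k * g, by rw [hk, hg, Subgroup.map_map]; ext; simp⟩ }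

/-- The set `𝓕/G` of conjugacy classes of subgroups in the family. -/
def ClassSet : Type u := Quotient 𝓕.conjSetoid

end FinSubgroupFamily

/-! ## Spans of `G`-sets -/

section Spans

variable {G : Type u} [Group G] (𝓕 : FinSubgroupFamily G)
variable (X Y Z W : Type u) [MulAction G X] [MulAction G Y] [MulAction G Z] [MulAction G W]

/-- A diagram `X ⟵ G/L ⟶ Y` of `G`-maps with `L ∈ 𝓕`. -/
structure SpanDiagram where
  L : Subgroup G
  mem : L ∈ 𝓕.carrier
  left : (G ⧸ L) →[G] X
  right : (G ⧸ L) →[G] Y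

/-- Two diagrams are equivalent if a bijective `G`-map between the middle terms commutes with
the legs. -/
def SpanDiagram.setoid : Setoid (SpanDiagram 𝓕 X Y) where
  r d e := ∃ σ : (G ⧸ d.L) →[G] (G ⧸ e.L), Function.Bijective σ ∧
    e.left.comp σ = d.left ∧ e.right.comp σ = d.right
  iseqv :=
    { refl := fun d => ⟨MulActionHom.id G, Function.bijective_id, by ext; rfl, by ext; rfl⟩
      symm := by
        rintro d e ⟨σ, hσ, hl, hr⟩
        obtain ⟨τ, h1, h2⟩ := Function.bijective_iff_has_inverse.mp hσ
        refine ⟨σ.inverse τ h1 h2, Function.bijective_iff_has_inverse.mpr ⟨σ, h2, h1⟩, ?_, ?_⟩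
        · rw [← hl]; ext x; exact congrArg e.left (h2 x)
        · rw [← hr]; ext x; exact congrArg e.right (h2 x)
      trans := by
        rintro d e f ⟨σ, hσ, hl, hr⟩ ⟨τ, hτ, hl', hr'⟩
        refine ⟨τ.comp σ, hτ.comp hσ, ?_, ?_⟩
        · rw [← hl, ← hl']; rfl
        · rw [← hr, ← hr']; rfl }

/-- Basic morphisms from `X` to `Y`: equivalence classes of diagrams `X ⟵ G/L ⟶ Y`. -/
def BasicSpan : Type u := Quotient (SpanDiagram.setoid 𝓕 X Y)

/-- The basic morphism represented by a diagram. -/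
def SpanDiagram.cls {𝓕 : FinSubgroupFamily G} {X Y : Type u} [MulAction G X] [MulAction G Y]
    (d : SpanDiagram 𝓕 X Y) : BasicSpan 𝓕 X Y :=
  Quotient.mk (SpanDiagram.setoid 𝓕 X Y) d

theorem BasicSpan.exists_cls {𝓕 : FinSubgroupFamily G} {X Y : Type u} [MulAction G X]
    [MulAction G Y] (b : BasicSpan 𝓕 X Y) : ∃ d : SpanDiagram 𝓕 X Y, d.cls = b :=
  Quotient.exists_rep (s := SpanDiagram.setoid 𝓕 X Y) b

/-- The free abelian group on the basic morphisms from `X` to `Y`. -/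
abbrev SpanGroup : Type u := FreeAbelianGroup (BasicSpan 𝓕 X Y)

variable {X Y Z W}

/-- The `G`-map `G/L ⟶ X` sending the trivial coset to a point fixed by `L`. -/
def cosetMap (L : Subgroup G) (x : X) (hx : L ≤ MulAction.stabilizer G x) : (G ⧸ L) →[G] X where
  toFun := Quotient.lift (fun g : G => g • x) (by
    intro a b hab
    have h := hx (QuotientGroup.leftRel_apply.mp hab)
    rw [MulAction.mem_stabilizer_iff, mul_smul, inv_smul_eq_iff] at h
    exact h.symm)
  map_smul' := by
    intro g q
    induction q using Quotient.inductionOn with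
    | h a => exact mul_smul g a x

theorem cosetMap_one (L : Subgroup G) (x : X) (hx : L ≤ MulAction.stabilizer G x) :
    cosetMap L x hx ((1 : G) : G ⧸ L) = x := one_smul G x

/-- A `G`-map out of `G/L` is determined by its value at the trivial coset. -/
theorem coset_hom_ext {L : Subgroup G} {f g : (G ⧸ L) →[G] X}
    (h : f ((1 : G) : G ⧸ L) = g ((1 : G) : G ⧸ L)) : f = g := by
  ext q
  induction q using QuotientGroup.induction_on with
  | H a =>
    have ha : (a : G ⧸ L) = a • ((1 : G) : G ⧸ L) := by
      rw [MulAction.Quotient.smul_coe, smul_eq_mul, mul_one]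
    rw [ha, map_smul, map_smul, h]

theorem comp_cosetMap (p : X →[G] Y) (L : Subgroup G) (x : X)
    (hx : L ≤ MulAction.stabilizer G x) (hy : L ≤ MulAction.stabilizer G (p x)) :
    p.comp (cosetMap L x hx) = cosetMap L (p x) hy :=
  coset_hom_ext ((congrArg p (cosetMap_one L x hx)).trans (cosetMap_one L (p x) hy).symm)

/-- The basic morphism `X ⟵ G/L ⟶ Y` sending the trivial coset to `x` and `y`. -/
def BasicSpan.mk (L : Subgroup G) (hL : L ∈ 𝓕.carrier) (x : X) (y : Y)
    (hx : L ≤ MulAction.stabilizer G x) (hy : L ≤ MulAction.stabilizer G y) :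
    BasicSpan 𝓕 X Y :=
  SpanDiagram.cls ⟨L, hL, cosetMap L x hx, cosetMap L y hy⟩

theorem BasicSpan.mk_congr {L L' : Subgroup G} {hL : L ∈ 𝓕.carrier} {hL' : L' ∈ 𝓕.carrier}
    {x x' : X} {y y' : Y} {hx : L ≤ MulAction.stabilizer G x} {hy : L ≤ MulAction.stabilizer G y}
    {hx' : L' ≤ MulAction.stabilizer G x'} {hy' : L' ≤ MulAction.stabilizer G y'}
    (h : L = L') (h1 : x = x') (h2 : y = y') :
    BasicSpan.mk 𝓕 L hL x y hx hy = BasicSpan.mk 𝓕 L' hL' x' y' hx' hy' := by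
  subst h h1 h2; rfl

end Spans

/-! ## The basic morphisms occurring in a span `X ⟵ P ⟶ Y` of `G`-sets -/

section Total

variable {G : Type u} [Group G] (𝓕 : FinSubgroupFamily G)

/-- All point stabilisers of the `G`-set `P` lie in the family. -/
def StabIn (P : Type u) [MulAction G P] : Prop :=
  ∀ a : P, MulAction.stabilizer G a ∈ 𝓕.carrier

variable {P Q X Y Z W : Type u} [MulAction G P] [MulAction G Q] [MulAction G X] [MulAction G Y]
  [MulAction G Z] [MulAction G W]

theorem stabilizer_le_map (p : P →[G] X) (a : P) :
    MulAction.stabilizer G a ≤ MulAction.stabilizer G (p a) := fun g hg => by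
  rw [MulAction.mem_stabilizer_iff] at *
  rw [← map_smul, hg]

theorem stabilizer_eq_of_injective (p : P →[G] X) (hp : Function.Injective p) (a : P) :
    MulAction.stabilizer G (p a) = MulAction.stabilizer G a := by
  ext g
  rw [MulAction.mem_stabilizer_iff, MulAction.mem_stabilizer_iff, ← map_smul]
  exact hp.eq_iff

theorem stabilizer_smul_eq_map (g : G) (a : P) :
    MulAction.stabilizer G (g • a)
      = (MulAction.stabilizer G a).map (MulAut.conj g).toMonoidHom :=
  MulAction.stabilizer_smul_eq_stabilizer_map_conj g a

theorem stabIn_coset {L : Subgroup G} (hL : L ∈ 𝓕.carrier) : StabIn 𝓕 (G ⧸ L) := by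
  intro q
  induction q using QuotientGroup.induction_on with
  | H a =>
    have ha : (a : G ⧸ L) = a • ((1 : G) : G ⧸ L) := by
      rw [MulAction.Quotient.smul_coe, smul_eq_mul, mul_one]
    rw [ha, stabilizer_smul_eq_map, MulAction.stabilizer_quotient]
    exact 𝓕.conj_mem L hL a

/-- The restriction `X ⟵ G/stab(a) ⟶ Y` of a span `X ⟵ P ⟶ Y` to the orbit of `a`. -/
def pointSpan (hP : StabIn 𝓕 P) (p : P →[G] X) (q : P →[G] Y) (a : P) : BasicSpan 𝓕 X Y :=
  BasicSpan.mk 𝓕 (MulAction.stabilizer G a) (hP a) (p a) (q a)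
    (stabilizer_le_map p a) (stabilizer_le_map q a)

/-- A basic morphism does not change under moving the base point of its middle term. -/
theorem pointSpan_eq_of_diagram (hP : StabIn 𝓕 P) (p : P →[G] X) (q : P →[G] Y) (d : SpanDiagram 𝓕 X Y)
    (f : (G ⧸ d.L) →[G] P) (hf : Function.Injective f) (hl : p.comp f = d.left)
    (hr : q.comp f = d.right) (c : G ⧸ d.L) :
    pointSpan 𝓕 hP p q (f c) = d.cls := by
  have hs : MulAction.stabilizer G (f c) = MulAction.stabilizer G c :=
    stabilizer_eq_of_injective f hf c
  refine Quotient.sound (s := SpanDiagram.setoid 𝓕 X Y)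
    ⟨cosetMap _ c hs.le, ⟨?_, ?_⟩, ?_, ?_⟩
  · intro a b
    induction a using QuotientGroup.induction_on with
    | H a =>
    induction b using QuotientGroup.induction_on with
    | H b =>
    intro h
    refine QuotientGroup.eq.mpr ?_
    have h' : a • c = b • c := h
    change a⁻¹ * b ∈ MulAction.stabilizer G (f c)
    rw [hs, MulAction.mem_stabilizer_iff, mul_smul, ← h', inv_smul_smul]
  · intro b
    obtain ⟨g, hg⟩ := MulAction.exists_smul_eq G c b
    exact ⟨(g : G ⧸ _), hg⟩
  · rw [← hl]
    exact comp_cosetMap (p.comp f) _ c _ (stabilizer_le_map p (f c))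
  · rw [← hr]
    exact comp_cosetMap (q.comp f) _ c _ (stabilizer_le_map q (f c))

theorem pointSpan_smul (hP : StabIn 𝓕 P) (p : P →[G] X) (q : P →[G] Y) (g : G) (a : P) :
    pointSpan 𝓕 hP p q (g • a) = pointSpan 𝓕 hP p q a := by
  have := pointSpan_eq_of_diagram 𝓕 hP p q
    ⟨MulAction.stabilizer G a, hP a, cosetMap _ (p a) (stabilizer_le_map p a),
      cosetMap _ (q a) (stabilizer_le_map q a)⟩
    (cosetMap _ a le_rfl) (MulAction.injective_ofQuotientStabilizer G a)
    (comp_cosetMap p _ a _ (stabilizer_le_map p a))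
    (comp_cosetMap q _ a _ (stabilizer_le_map q a)) (g : G ⧸ _)
  exact this

/-- The basic morphism attached to an orbit of `P`. -/
def orbitSpan (hP : StabIn 𝓕 P) (p : P →[G] X) (q : P →[G] Y) :
    MulAction.orbitRel.Quotient G P → BasicSpan 𝓕 X Y :=
  Quotient.lift (pointSpan 𝓕 hP p q) (by
    rintro a b ⟨g, hg⟩
    rw [← hg]
    exact pointSpan_smul 𝓕 hP p q g b)

/-- The element of `SpanGroup 𝓕 X Y` given by a span `X ⟵ P ⟶ Y`: the sum of the basic
morphisms obtained by restricting it to the orbits of `P` (used when there are finitely many). -/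
def total (hP : StabIn 𝓕 P) (p : P →[G] X) (q : P →[G] Y) : SpanGroup 𝓕 X Y :=
  ∑ᶠ ω : MulAction.orbitRel.Quotient G P, FreeAbelianGroup.of (orbitSpan 𝓕 hP p q ω)

theorem total_congr (hP : StabIn 𝓕 P) (p : P →[G] X) (q : P →[G] Y) (hQ : StabIn 𝓕 Q)
    (p' : Q →[G] X) (q' : Q →[G] Y) (f : P →[G] Q) (hf : Function.Bijective f)
    (hp : ∀ a, p' (f a) = p a) (hq : ∀ a, q' (f a) = q a) :
    total 𝓕 hP p q = total 𝓕 hQ p' q' := by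
  let F : MulAction.orbitRel.Quotient G P → MulAction.orbitRel.Quotient G Q :=
    Quotient.map f (by rintro a b ⟨g, hg⟩; exact ⟨g, by rw [← hg]; exact (map_smul f g b).symm⟩)
  refine finsum_eq_of_bijective F ⟨?_, ?_⟩ ?_
  · intro a b
    induction a using Quotient.inductionOn with
    | h a =>
    induction b using Quotient.inductionOn with
    | h b =>
    intro h
    obtain ⟨g, hg⟩ := Quotient.exact h
    refine Quotient.sound ⟨g, hf.1 ?_⟩
    rw [← hg]; exact map_smul f g b
  · intro b
    induction b using Quotient.inductionOn with
    | h b =>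
    obtain ⟨a, rfl⟩ := hf.2 b
    exact ⟨Quotient.mk _ a, rfl⟩
  · intro ω
    induction ω using Quotient.inductionOn with
    | h a =>
    refine congrArg (FreeAbelianGroup.of) ?_
    exact BasicSpan.mk_congr 𝓕 (stabilizer_eq_of_injective f hf.1 a).symm (hp a).symm (hq a).symm

theorem total_diagram (d : SpanDiagram 𝓕 X Y) :
    total 𝓕 (stabIn_coset 𝓕 d.mem) d.left d.right
      = FreeAbelianGroup.of d.cls := by
  let ω₀ : MulAction.orbitRel.Quotient G (G ⧸ d.L) := Quotient.mk _ ((1 : G) : G ⧸ d.L)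
  have hω : ∀ ω : MulAction.orbitRel.Quotient G (G ⧸ d.L), ω = ω₀ := by
    intro ω
    induction ω using Quotient.inductionOn with
    | h a => exact Quotient.sound (MulAction.exists_smul_eq G _ a)
  rw [total, finsum_eq_single _ ω₀ fun ω h => absurd (hω ω) h]
  exact congrArg (FreeAbelianGroup.of) (pointSpan_eq_of_diagram 𝓕 (stabIn_coset 𝓕 d.mem) d.left
    d.right d (MulActionHom.id G) Function.injective_id (by ext; rfl) (by ext; rfl) _)

/-! ### Pullbacks and composition -/

/-- The pullback `P ×_Y Q` of `G`-sets. -/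
def Pull (q : P →[G] Y) (p' : Q →[G] Y) : Type u := { t : P × Q // q t.1 = p' t.2 }

instance (q : P →[G] Y) (p' : Q →[G] Y) : MulAction G (Pull q p') where
  smul g t := ⟨(g • t.1.1, g • t.1.2), by rw [map_smul, map_smul, t.2]⟩
  one_smul t := Subtype.ext (one_smul G t.1)
  mul_smul g h t := Subtype.ext (mul_smul g h t.1)

def Pull.fst (q : P →[G] Y) (p' : Q →[G] Y) : Pull q p' →[G] P where
  toFun t := t.1.1
  map_smul' _ _ := rfl

def Pull.snd (q : P →[G] Y) (p' : Q →[G] Y) : Pull q p' →[G] Q where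
  toFun t := t.1.2
  map_smul' _ _ := rfl

theorem stabIn_pull (hP : StabIn 𝓕 P) (q : P →[G] Y) (p' : Q →[G] Y) : StabIn 𝓕 (Pull q p') :=
  fun t => 𝓕.le_mem _ (hP t.1.1) _ (stabilizer_le_map (Pull.fst q p') t)

theorem stabilizer_pull (q : P →[G] Y) (p' : Q →[G] Y) (t : Pull q p') :
    MulAction.stabilizer G t
      = MulAction.stabilizer G t.1.1 ⊓ MulAction.stabilizer G t.1.2 := by
  ext g
  simp only [Subgroup.mem_inf, MulAction.mem_stabilizer_iff]
  constructor
  · intro h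
    have := congrArg Subtype.val h
    exact ⟨congrArg Prod.fst this, congrArg Prod.snd this⟩
  · rintro ⟨h1, h2⟩
    exact Subtype.ext (Prod.ext h1 h2)

/-- The pullback of `G`-sets with finitely many orbits has finitely many orbits, if the base has
stabilisers in the family. -/
theorem finite_orbits_pull (hY : StabIn 𝓕 Y) (q : P →[G] Y) (p' : Q →[G] Y)
    [Finite (MulAction.orbitRel.Quotient G P)] [Finite (MulAction.orbitRel.Quotient G Q)] :
    Finite (MulAction.orbitRel.Quotient G (Pull q p')) := by
  let T := Σ ω : MulAction.orbitRel.Quotient G P × MulAction.orbitRel.Quotient G Q,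
    { g : G // q ω.1.out = p' (g • ω.2.out) }
  have : ∀ ω : MulAction.orbitRel.Quotient G P × MulAction.orbitRel.Quotient G Q,
      Finite { g : G // q ω.1.out = p' (g • ω.2.out) } := by
    intro ω
    by_cases hne : Nonempty { g : G // q ω.1.out = p' (g • ω.2.out) }
    · obtain ⟨g₀, h₀⟩ := hne
      have := 𝓕.finite _ (hY (p' ω.2.out))
      refine Finite.of_injective (β := MulAction.stabilizer G (p' ω.2.out))
        (fun g => ⟨g₀⁻¹ * g.1, ?_⟩) ?_
      · rw [MulAction.mem_stabilizer_iff, mul_smul, ← map_smul, ← g.2, h₀, map_smul,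
          inv_smul_smul]
      · intro a b h
        exact Subtype.ext (mul_left_cancel (congrArg Subtype.val h))
    · rw [not_nonempty_iff] at hne
      infer_instance
  let f : T → MulAction.orbitRel.Quotient G (Pull q p') := fun t =>
    Quotient.mk _ ⟨(t.1.1.out, t.2.1 • t.1.2.out), t.2.2⟩
  refine Finite.of_surjective f ?_
  intro θ
  induction θ using Quotient.inductionOn with
  | h t =>
  obtain ⟨⟨a, b⟩, hab⟩ := t
  obtain ⟨g, hg⟩ := Quotient.exact
    (Quotient.out_eq (Quotient.mk (MulAction.orbitRel G P) a))
  obtain ⟨k, hk⟩ := Quotient.exact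
    (Quotient.out_eq (Quotient.mk (MulAction.orbitRel G Q) b))
  dsimp only at hg hk hab
  refine ⟨⟨(Quotient.mk _ a, Quotient.mk _ b), ⟨g * k⁻¹, ?_⟩⟩, ?_⟩
  · dsimp only
    rw [← hk, ← hg, mul_smul, inv_smul_smul, map_smul, map_smul, hab]
  · refine Quotient.sound ⟨g, Subtype.ext (Prod.ext hg ?_)⟩
    change g • b = (g * k⁻¹) • _
    rw [← hk, mul_smul, inv_smul_smul]

instance (L : Subgroup G) : Finite (MulAction.orbitRel.Quotient G (G ⧸ L)) := by
  have : Subsingleton (MulAction.orbitRel.Quotient G (G ⧸ L)) := ⟨fun a b => by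
    induction a using Quotient.inductionOn with
    | h a =>
    induction b using Quotient.inductionOn with
    | h b => exact Quotient.sound (MulAction.exists_smul_eq G b a)⟩
  infer_instance

/-- Composition of diagrams `X ⟵ G/L ⟶ Y` and `Y ⟵ G/S ⟶ Z`: the pullback over `Y`, decomposed
into orbits. -/
def SpanDiagram.comp (d : SpanDiagram 𝓕 X Y) (e : SpanDiagram 𝓕 Y Z) : SpanGroup 𝓕 X Z :=
  total 𝓕 (stabIn_pull 𝓕 (stabIn_coset 𝓕 d.mem) d.right e.left)
    (d.left.comp (Pull.fst d.right e.left)) (e.right.comp (Pull.snd d.right e.left))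

/-- Composition of basic morphisms. -/
def BasicSpan.comp : BasicSpan 𝓕 X Y → BasicSpan 𝓕 Y Z → SpanGroup 𝓕 X Z :=
  Quotient.lift₂ (s₁ := SpanDiagram.setoid 𝓕 X Y) (s₂ := SpanDiagram.setoid 𝓕 Y Z)
    (SpanDiagram.comp 𝓕) (by
      rintro d e d' e' ⟨σ, hσ, hl, hr⟩ ⟨τ, hτ, hl', hr'⟩
      let f : Pull d.right e.left →[G] Pull d'.right e'.left :=
        { toFun := fun t => ⟨(σ t.1.1, τ t.1.2), by
            have h1 : d'.right (σ t.1.1) = d.right t.1.1 := DFunLike.congr_fun hr t.1.1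
            have h2 : e'.left (τ t.1.2) = e.left t.1.2 := DFunLike.congr_fun hl' t.1.2
            exact h1.trans (t.2.trans h2.symm)⟩
          map_smul' := fun g t => Subtype.ext
            (Prod.ext (map_smul σ g t.1.1) (map_smul τ g t.1.2)) }
      refine total_congr 𝓕 _ _ _ _ _ _ f ⟨?_, ?_⟩ ?_ ?_
      · intro a b h
        have := congrArg Subtype.val h
        exact Subtype.ext (Prod.ext (hσ.1 (congrArg Prod.fst this))
          (hτ.1 (congrArg Prod.snd this)))
      · rintro ⟨⟨a, b⟩, hab⟩
        obtain ⟨a, rfl⟩ := hσ.2 a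
        obtain ⟨b, rfl⟩ := hτ.2 b
        refine ⟨⟨(a, b), ?_⟩, rfl⟩
        have h1 : d'.right (σ a) = d.right a := DFunLike.congr_fun hr a
        have h2 : e'.left (τ b) = e.left b := DFunLike.congr_fun hl' b
        exact h1.symm.trans (hab.trans h2)
      · intro t; exact DFunLike.congr_fun hl t.1.1
      · intro t; exact DFunLike.congr_fun hr' t.1.2)

/-- Composition of morphisms, extended biadditively from basic morphisms. -/
def SpanGroup.comp : SpanGroup 𝓕 X Y →+ SpanGroup 𝓕 Y Z →+ SpanGroup 𝓕 X Z :=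
  FreeAbelianGroup.lift fun b => FreeAbelianGroup.lift fun c => BasicSpan.comp 𝓕 b c

theorem SpanGroup.comp_of (b : BasicSpan 𝓕 X Y) (c : BasicSpan 𝓕 Y Z) :
    SpanGroup.comp 𝓕 (FreeAbelianGroup.of b) (FreeAbelianGroup.of c) = BasicSpan.comp 𝓕 b c := by
  rw [SpanGroup.comp, FreeAbelianGroup.lift_apply_of, FreeAbelianGroup.lift_apply_of]

/-- Spans of `G`-sets with finitely many orbits compose by pullback. -/
theorem total_comp_total (hY : StabIn 𝓕 Y)
    [Finite (MulAction.orbitRel.Quotient G P)] [Finite (MulAction.orbitRel.Quotient G Q)]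
    (hP : StabIn 𝓕 P) (p : P →[G] X) (q : P →[G] Y)
    (hQ : StabIn 𝓕 Q) (p' : Q →[G] Y) (q' : Q →[G] Z) :
    SpanGroup.comp 𝓕 (total 𝓕 hP p q) (total 𝓕 hQ p' q')
      = total 𝓕 (stabIn_pull 𝓕 hP q p') (p.comp (Pull.fst q p')) (q'.comp (Pull.snd q p')) := by
  classical
  let A := MulAction.orbitRel.Quotient G P
  let B := MulAction.orbitRel.Quotient G Q
  let dA : A → SpanDiagram 𝓕 X Y := fun ω =>
    ⟨MulAction.stabilizer G ω.out, hP _, cosetMap _ (p ω.out) (stabilizer_le_map p _),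
      cosetMap _ (q ω.out) (stabilizer_le_map q _)⟩
  let dB : B → SpanDiagram 𝓕 Y Z := fun ω =>
    ⟨MulAction.stabilizer G ω.out, hQ _, cosetMap _ (p' ω.out) (stabilizer_le_map p' _),
      cosetMap _ (q' ω.out) (stabilizer_le_map q' _)⟩
  let iA : ∀ ω : A, (G ⧸ (dA ω).L) →[G] P := fun ω => cosetMap _ ω.out le_rfl
  let iB : ∀ ω : B, (G ⧸ (dB ω).L) →[G] Q := fun ω => cosetMap _ ω.out le_rfl
  have iA_inj : ∀ ω, Function.Injective (iA ω) := fun ω =>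
    MulAction.injective_ofQuotientStabilizer G _
  have iB_inj : ∀ ω, Function.Injective (iB ω) := fun ω =>
    MulAction.injective_ofQuotientStabilizer G _
  have iA_left : ∀ ω u, p (iA ω u) = (dA ω).left u := fun ω u =>
    DFunLike.congr_fun (comp_cosetMap p _ ω.out _ (stabilizer_le_map p _)) u
  have iA_right : ∀ ω u, q (iA ω u) = (dA ω).right u := fun ω u =>
    DFunLike.congr_fun (comp_cosetMap q _ ω.out _ (stabilizer_le_map q _)) u
  have iB_left : ∀ ω u, p' (iB ω u) = (dB ω).left u := fun ω u =>
    DFunLike.congr_fun (comp_cosetMap p' _ ω.out _ (stabilizer_le_map p' _)) u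
  have iB_right : ∀ ω u, q' (iB ω u) = (dB ω).right u := fun ω u =>
    DFunLike.congr_fun (comp_cosetMap q' _ ω.out _ (stabilizer_le_map q' _)) u
  have iA_orb : ∀ (ω : A) u, (Quotient.mk _ (iA ω u) : A) = ω := by
    intro ω u
    refine Eq.trans (Quotient.sound ?_) (Quotient.out_eq ω)
    exact MulAction.ofQuotientStabilizer_mem_orbit G _ u
  have iB_orb : ∀ (ω : B) u, (Quotient.mk _ (iB ω u) : B) = ω := by
    intro ω u
    refine Eq.trans (Quotient.sound ?_) (Quotient.out_eq ω)
    exact MulAction.ofQuotientStabilizer_mem_orbit G _ u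
  have iA_surj : ∀ a : P, ∃ u, iA (Quotient.mk _ a) u = a := by
    intro a
    obtain ⟨g, hg⟩ := Quotient.exact
      (Quotient.out_eq (Quotient.mk (MulAction.orbitRel G P) a)).symm
    exact ⟨(g : G ⧸ _), hg⟩
  have iB_surj : ∀ a : Q, ∃ u, iB (Quotient.mk _ a) u = a := by
    intro a
    obtain ⟨g, hg⟩ := Quotient.exact
      (Quotient.out_eq (Quotient.mk (MulAction.orbitRel G Q) a)).symm
    exact ⟨(g : G ⧸ _), hg⟩
  have hA : ∀ ω : A, orbitSpan 𝓕 hP p q ω = (dA ω).cls := by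
    intro ω
    conv_lhs => rw [← Quotient.out_eq ω]
    rfl
  have hB : ∀ ω : B, orbitSpan 𝓕 hQ p' q' ω = (dB ω).cls := by
    intro ω
    conv_lhs => rw [← Quotient.out_eq ω]
    rfl
  let PB : A × B → Type u := fun w => Pull (dA w.1).right (dB w.2).left
  let j : ∀ w : A × B, PB w →[G] Pull q p' := fun w =>
    { toFun := fun t => ⟨(iA w.1 t.1.1, iB w.2 t.1.2),
        (iA_right _ _).trans (t.2.trans (iB_left _ _).symm)⟩
      map_smul' := fun g t => Subtype.ext
        (Prod.ext (map_smul (iA w.1) g t.1.1) (map_smul (iB w.2) g t.1.2)) }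
  have j_inj : ∀ w, Function.Injective (j w) := by
    intro w a b h
    have := congrArg Subtype.val h
    exact Subtype.ext (Prod.ext (iA_inj _ (congrArg Prod.fst this))
      (iB_inj _ (congrArg Prod.snd this)))
  have : ∀ w : A × B, Finite (MulAction.orbitRel.Quotient G (PB w)) := fun w =>
    finite_orbits_pull 𝓕 hY _ _
  let J : (Σ w : A × B, MulAction.orbitRel.Quotient G (PB w)) →
      MulAction.orbitRel.Quotient G (Pull q p') := fun s =>
    Quotient.map (j s.1) (by
      rintro a b ⟨g, hg⟩
      exact ⟨g, by rw [← hg]; exact (map_smul (j s.1) g b).symm⟩) s.2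
  have J_bij : Function.Bijective J := by
    constructor
    · rintro ⟨w, s⟩ ⟨w', s'⟩ h
      induction s using Quotient.inductionOn with
      | h s =>
      induction s' using Quotient.inductionOn with
      | h s' =>
      obtain ⟨g, hg⟩ := Quotient.exact h
      have hg' := congrArg Subtype.val hg
      have h1 : g • iA w'.1 s'.1.1 = iA w.1 s.1.1 := congrArg Prod.fst hg'
      have h2 : g • iB w'.2 s'.1.2 = iB w.2 s.1.2 := congrArg Prod.snd hg'
      have hw : w = w' := by
        refine Prod.ext ?_ ?_
        · rw [← iA_orb w.1 s.1.1, ← iA_orb w'.1 s'.1.1]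
          exact Quotient.sound ⟨g, h1⟩
        · rw [← iB_orb w.2 s.1.2, ← iB_orb w'.2 s'.1.2]
          exact Quotient.sound ⟨g, h2⟩
      subst hw
      refine congrArg (Sigma.mk w) (Quotient.sound ⟨g, j_inj w ?_⟩)
      exact (map_smul (j w) g s').trans hg
    · intro θ
      induction θ using Quotient.inductionOn with
      | h t =>
      obtain ⟨⟨a, b⟩, hab⟩ := t
      obtain ⟨x, hx⟩ := iA_surj a
      obtain ⟨y, hy⟩ := iB_surj b
      refine ⟨⟨(Quotient.mk _ a, Quotient.mk _ b), Quotient.mk _ ⟨(x, y), ?_⟩⟩, ?_⟩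
      · dsimp only
        rw [← iA_right, ← iB_left, hx, hy]
        exact hab
      · exact congrArg (Quotient.mk _) (Subtype.ext (Prod.ext hx hy))
  have := Fintype.ofFinite A
  have := Fintype.ofFinite B
  have := fun w => Fintype.ofFinite (MulAction.orbitRel.Quotient G (PB w))
  have key : ∀ w : A × B,
      SpanGroup.comp 𝓕 (FreeAbelianGroup.of (orbitSpan 𝓕 hP p q w.1))
        (FreeAbelianGroup.of (orbitSpan 𝓕 hQ p' q' w.2))
      = ∑ τ : MulAction.orbitRel.Quotient G (PB w), FreeAbelianGroup.of
          (orbitSpan 𝓕 (stabIn_pull 𝓕 hP q p') (p.comp (Pull.fst q p'))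
            (q'.comp (Pull.snd q p')) (J ⟨w, τ⟩)) := by
    intro w
    rw [hA, hB, SpanGroup.comp_of]
    change total 𝓕 _ _ _ = _
    rw [total, finsum_eq_sum_of_fintype]
    refine Finset.sum_congr rfl fun τ _ => congrArg (FreeAbelianGroup.of) ?_
    induction τ using Quotient.inductionOn with
    | h t =>
    exact BasicSpan.mk_congr 𝓕 (stabilizer_eq_of_injective (j w) (j_inj w) t).symm
      (iA_left w.1 t.1.1).symm (iB_right w.2 t.1.2).symm
  conv_rhs => rw [total]
  rw [← finsum_eq_of_bijective J J_bij (fun _ => rfl), finsum_eq_sum_of_fintype,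
    Fintype.sum_sigma]
  simp_rw [← key]
  rw [Fintype.sum_prod_type_right, total, total, finsum_eq_sum_of_fintype,
    finsum_eq_sum_of_fintype, map_sum]
  refine Finset.sum_congr rfl fun ω _ => ?_
  rw [map_sum, AddMonoidHom.finsetSum_apply]

theorem SpanDiagram.comp_assoc (hY : StabIn 𝓕 Y) (hZ : StabIn 𝓕 Z) (b : SpanDiagram 𝓕 X Y)
    (c : SpanDiagram 𝓕 Y Z) (e : SpanDiagram 𝓕 Z W) :
    SpanGroup.comp 𝓕 (SpanGroup.comp 𝓕 (FreeAbelianGroup.of b.cls) (FreeAbelianGroup.of c.cls))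
        (FreeAbelianGroup.of e.cls)
      = SpanGroup.comp 𝓕 (FreeAbelianGroup.of b.cls)
        (SpanGroup.comp 𝓕 (FreeAbelianGroup.of c.cls) (FreeAbelianGroup.of e.cls)) := by
  have := finite_orbits_pull 𝓕 hY b.right c.left
  have := finite_orbits_pull 𝓕 hZ c.right e.left
  rw [← total_diagram, ← total_diagram, ← total_diagram, total_comp_total 𝓕 hY,
    total_comp_total 𝓕 hZ, total_comp_total 𝓕 hZ, total_comp_total 𝓕 hY]
  refine total_congr 𝓕 _ _ _ _ _ _
    { toFun := fun t => ⟨(t.1.1.1.1, ⟨(t.1.1.1.2, t.1.2), t.2⟩), t.1.1.2⟩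
      map_smul' := fun _ _ => rfl } ⟨?_, ?_⟩ (fun _ => rfl) (fun _ => rfl)
  · rintro ⟨⟨⟨⟨a, b⟩, h1⟩, c⟩, h2⟩ ⟨⟨⟨⟨a', b'⟩, h1'⟩, c'⟩, h2'⟩ h
    have h0 := congrArg Subtype.val h
    have ha : a = a' := congrArg Prod.fst h0
    have hbc := congrArg Subtype.val (congrArg Prod.snd h0)
    have hb : b = b' := congrArg Prod.fst hbc
    have hc : c = c' := congrArg Prod.snd hbc
    subst ha hb hc
    rfl
  · rintro ⟨⟨a, ⟨⟨b, c⟩, h1⟩⟩, h2⟩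
    exact ⟨⟨(⟨(a, b), h2⟩, c), h1⟩, rfl⟩

theorem SpanGroup.comp_assoc (hY : StabIn 𝓕 Y) (hZ : StabIn 𝓕 Z) (f : SpanGroup 𝓕 X Y)
    (g : SpanGroup 𝓕 Y Z) (h : SpanGroup 𝓕 Z W) :
    SpanGroup.comp 𝓕 (SpanGroup.comp 𝓕 f g) h = SpanGroup.comp 𝓕 f (SpanGroup.comp 𝓕 g h) := by
  induction f using FreeAbelianGroup.induction_on with
  | zero => simp only [map_zero, AddMonoidHom.zero_apply]
  | neg f hf => simp only [map_neg, AddMonoidHom.neg_apply, hf]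
  | add f k hf hk => simp only [map_add, AddMonoidHom.add_apply, hf, hk]
  | of b =>
    induction g using FreeAbelianGroup.induction_on with
    | zero => simp only [map_zero, AddMonoidHom.zero_apply]
    | neg g hg => simp only [map_neg, AddMonoidHom.neg_apply, hg]
    | add g k hg hk => simp only [map_add, AddMonoidHom.add_apply, hg, hk]
    | of c =>
      induction h using FreeAbelianGroup.induction_on with
      | zero => simp only [map_zero]
      | neg h hh => simp only [map_neg, hh]
      | add h k hh hk => simp only [map_add, hh, hk]
      | of e =>
        obtain ⟨b, rfl⟩ := b.exists_cls
        obtain ⟨c, rfl⟩ := c.exists_cls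
        obtain ⟨e, rfl⟩ := e.exists_cls
        exact SpanDiagram.comp_assoc 𝓕 hY hZ b c e

/-- The identity morphism `G/H ⟵ G/H ⟶ G/H`. -/
def SpanGroup.one {H : Subgroup G} (hH : H ∈ 𝓕.carrier) : SpanGroup 𝓕 (G ⧸ H) (G ⧸ H) :=
  FreeAbelianGroup.of
    (SpanDiagram.cls ⟨H, hH, MulActionHom.id G, MulActionHom.id G⟩)

theorem SpanGroup.one_comp {H : Subgroup G} (hH : H ∈ 𝓕.carrier) (f : SpanGroup 𝓕 (G ⧸ H) Y) :
    SpanGroup.comp 𝓕 (SpanGroup.one 𝓕 hH) f = f := by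
  refine DFunLike.congr_fun (FreeAbelianGroup.lift_ext
    (g := SpanGroup.comp 𝓕 (SpanGroup.one 𝓕 hH)) (h := AddMonoidHom.id _) fun b => ?_) f
  obtain ⟨b, rfl⟩ := b.exists_cls
  rw [SpanGroup.one, SpanGroup.comp_of, AddMonoidHom.id_apply, ← total_diagram]
  refine total_congr 𝓕 _ _ _ _ _ _ (Pull.snd _ _) ⟨?_, ?_⟩ ?_ (fun _ => rfl)
  · rintro ⟨⟨a, b⟩, h⟩ ⟨⟨a', b'⟩, h'⟩ (hb : b = b')
    subst hb
    exact Subtype.ext (Prod.ext (h.trans h'.symm) rfl)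
  · intro c
    exact ⟨⟨(b.left c, c), rfl⟩, rfl⟩
  · intro t; exact t.2.symm

theorem SpanGroup.comp_one {H : Subgroup G} (hH : H ∈ 𝓕.carrier) (f : SpanGroup 𝓕 X (G ⧸ H)) :
    SpanGroup.comp 𝓕 f (SpanGroup.one 𝓕 hH) = f := by
  refine DFunLike.congr_fun (FreeAbelianGroup.lift_ext
    (g := (SpanGroup.comp 𝓕).flip (SpanGroup.one 𝓕 hH)) (h := AddMonoidHom.id _) fun b => ?_) f
  obtain ⟨b, rfl⟩ := b.exists_cls
  rw [AddMonoidHom.flip_apply, SpanGroup.one, SpanGroup.comp_of, AddMonoidHom.id_apply,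
    ← total_diagram]
  refine total_congr 𝓕 _ _ _ _ _ _ (Pull.fst _ _) ⟨?_, ?_⟩ (fun _ => rfl) ?_
  · rintro ⟨⟨a, b⟩, h⟩ ⟨⟨a', b'⟩, h'⟩ (hb : a = a')
    subst hb
    exact Subtype.ext (Prod.ext rfl (h.symm.trans h'))
  · intro c
    exact ⟨⟨(c, b.right c), rfl⟩, rfl⟩
  · intro t; exact t.2

end Total

/-! ## The Mackey category and the Burnside functor -/

section Mackey

variable {G : Type u} [Group G]

/-- The Mackey category: objects are the `G`-sets `G/H` with `H ∈ 𝓕`. -/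
structure MackeyCat (𝓕 : FinSubgroupFamily G) : Type u where
  H : Subgroup G
  mem : H ∈ 𝓕.carrier

variable (𝓕 : FinSubgroupFamily G)

instance : SmallCategory (MackeyCat 𝓕) where
  Hom A B := SpanGroup 𝓕 (G ⧸ A.H) (G ⧸ B.H)
  id A := SpanGroup.one 𝓕 A.mem
  comp f g := SpanGroup.comp 𝓕 f g
  id_comp f := SpanGroup.one_comp 𝓕 _ f
  comp_id f := SpanGroup.comp_one 𝓕 _ f
  assoc {A B C _} f g h :=
    SpanGroup.comp_assoc 𝓕 (stabIn_coset 𝓕 B.mem) (stabIn_coset 𝓕 C.mem) f g h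

instance (A B : MackeyCat 𝓕) : AddCommGroup (A ⟶ B) :=
  inferInstanceAs (AddCommGroup (SpanGroup 𝓕 (G ⧸ A.H) (G ⧸ B.H)))

instance : Preadditive (MackeyCat 𝓕) where
  add_comp _ _ _ f f' g := by
    change SpanGroup.comp 𝓕 (f + f') g = _
    rw [map_add]; rfl
  comp_add _ _ _ f g g' := map_add (SpanGroup.comp 𝓕 f) g g'

variable (R : Type v) [CommRing R]

/-- The Burnside functor `B^G = R[-, G/G]`: its value at `G/H` is `R ⊗ -` of the free abelian
group on equivalence classes of diagrams `G/H ⟵ G/L ⟶ G/G` with `L ∈ 𝓕`, and morphisms of the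
Mackey category act by composition. (`G/G` itself need not be an object of the category.) -/
def burnsideModule : CatModule R (MackeyCat 𝓕) where
  obj :=
    { obj := fun A => ModuleCat.of R (R ⊗[ℤ] SpanGroup 𝓕 (G ⧸ A.unop.H) (G ⧸ (⊤ : Subgroup G)))
      map := fun f => ModuleCat.ofHom (LinearMap.baseChange R
        (SpanGroup.comp 𝓕 (Z := G ⧸ (⊤ : Subgroup G)) f.unop).toIntLinearMap)
      map_id := fun A => by
        ext1
        refine TensorProduct.AlgebraTensorModule.curry_injective ?_
        ext a
        exact congrArg (fun t => (1 : R) ⊗ₜ[ℤ] t) (SpanGroup.one_comp 𝓕 A.unop.mem a)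
      map_comp := fun {A B C} f g => by
        ext1
        refine TensorProduct.AlgebraTensorModule.curry_injective ?_
        ext a
        exact congrArg (fun t => (1 : R) ⊗ₜ[ℤ] t) (SpanGroup.comp_assoc 𝓕
          (stabIn_coset 𝓕 B.unop.mem) (stabIn_coset 𝓕 A.unop.mem) g.unop f.unop a) }
  property := by
    refine ⟨fun {A B f g} => ?_⟩
    ext1
    refine TensorProduct.AlgebraTensorModule.curry_injective ?_
    ext a
    change (1 : R) ⊗ₜ[ℤ] SpanGroup.comp 𝓕 (f.unop + g.unop) a
      = (1 : R) ⊗ₜ[ℤ] SpanGroup.comp 𝓕 f.unop a + (1 : R) ⊗ₜ[ℤ] SpanGroup.comp 𝓕 g.unop a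
    rw [← TensorProduct.tmul_add]
    refine congrArg (fun t => (1 : R) ⊗ₜ[ℤ] t) ?_
    exact DFunLike.congr_fun (map_add (SpanGroup.comp 𝓕) f.unop g.unop) a

/-- `G` is of type `M_𝓕-FP_n` over `R`: the Burnside functor is of type `FP_n`. -/
def IsMackeyFP (n : ℕ) : Prop := (burnsideModule 𝓕 R).IsFP n

end Mackey

/-! ## The orbit category and Bredon modules -/

section Orbit

variable {G : Type u} [Group G]

/-- The orbit category: objects are the `G`-sets `G/H` with `H ∈ 𝓕`, and morphisms are the free
abelian groups on `G`-maps. -/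
structure OrbitCat (𝓕 : FinSubgroupFamily G) : Type u where
  H : Subgroup G
  mem : H ∈ 𝓕.carrier

/-- The free abelian group on the `G`-maps from `X` to `Y`. -/
abbrev MapGroup (G X Y : Type u) [Group G] [MulAction G X] [MulAction G Y] : Type u :=
  FreeAbelianGroup (X →[G] Y)

/-- Biadditive extension of the composition of `G`-maps. -/
def MapGroup.comp {X Y Z : Type u} [MulAction G X] [MulAction G Y] [MulAction G Z] :
    MapGroup G X Y →+ MapGroup G Y Z →+ MapGroup G X Z :=
  FreeAbelianGroup.lift fun f => FreeAbelianGroup.lift fun g => FreeAbelianGroup.of (g.comp f)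

/-- The sum of the coefficients. -/
def MapGroup.aug {X Y : Type u} [MulAction G X] [MulAction G Y] : MapGroup G X Y →+ ℤ :=
  FreeAbelianGroup.lift fun _ => 1

section

variable {X Y Z W : Type u} [MulAction G X] [MulAction G Y] [MulAction G Z] [MulAction G W]

theorem MapGroup.comp_of (f : X →[G] Y) (g : Y →[G] Z) :
    MapGroup.comp (FreeAbelianGroup.of f) (FreeAbelianGroup.of g)
      = FreeAbelianGroup.of (g.comp f) := by
  rw [MapGroup.comp, FreeAbelianGroup.lift_apply_of, FreeAbelianGroup.lift_apply_of]

theorem MapGroup.aug_of (f : X →[G] Y) : MapGroup.aug (FreeAbelianGroup.of f) = 1 := by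
  rw [MapGroup.aug, FreeAbelianGroup.lift_apply_of]

theorem MapGroup.id_comp (f : MapGroup G X Y) :
    MapGroup.comp (FreeAbelianGroup.of (MulActionHom.id G)) f = f := by
  induction f using FreeAbelianGroup.induction_on with
  | zero => exact map_zero _
  | of g => rw [MapGroup.comp_of]; rfl
  | neg g h => rw [map_neg, h]
  | add g k hg hk => rw [map_add, hg, hk]

theorem MapGroup.comp_id (f : MapGroup G X Y) :
    MapGroup.comp f (FreeAbelianGroup.of (MulActionHom.id G)) = f := by
  induction f using FreeAbelianGroup.induction_on with
  | zero => rw [map_zero]; rfl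
  | of g => rw [MapGroup.comp_of]; rfl
  | neg g h => rw [map_neg, AddMonoidHom.neg_apply, h]
  | add g k hg hk => rw [map_add, AddMonoidHom.add_apply, hg, hk]

theorem MapGroup.assoc (f : MapGroup G X Y) (g : MapGroup G Y Z) (h : MapGroup G Z W) :
    MapGroup.comp (MapGroup.comp f g) h = MapGroup.comp f (MapGroup.comp g h) := by
  induction f using FreeAbelianGroup.induction_on with
  | zero => simp only [map_zero, AddMonoidHom.zero_apply]
  | neg f hf => simp only [map_neg, AddMonoidHom.neg_apply, hf]
  | add f k hf hk => simp only [map_add, AddMonoidHom.add_apply, hf, hk]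
  | of f =>
    induction g using FreeAbelianGroup.induction_on with
    | zero => simp only [map_zero, AddMonoidHom.zero_apply]
    | neg g hg => simp only [map_neg, AddMonoidHom.neg_apply, hg]
    | add g k hg hk => simp only [map_add, AddMonoidHom.add_apply, hg, hk]
    | of g =>
      induction h using FreeAbelianGroup.induction_on with
      | zero => simp only [map_zero]
      | neg h hh => simp only [map_neg, hh]
      | add h k hh hk => simp only [map_add, hh, hk]
      | of h => rw [MapGroup.comp_of, MapGroup.comp_of, MapGroup.comp_of, MapGroup.comp_of]; rfl

theorem MapGroup.aug_comp (f : MapGroup G X Y) (g : MapGroup G Y Z) :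
    MapGroup.aug (MapGroup.comp f g) = MapGroup.aug f * MapGroup.aug g := by
  induction f using FreeAbelianGroup.induction_on with
  | zero => simp only [map_zero, AddMonoidHom.zero_apply, zero_mul]
  | neg f hf => simp only [map_neg, AddMonoidHom.neg_apply, hf, neg_mul]
  | add f k hf hk => simp only [map_add, AddMonoidHom.add_apply, hf, hk, add_mul]
  | of f =>
    induction g using FreeAbelianGroup.induction_on with
    | zero => simp only [map_zero, mul_zero]
    | neg g hg => simp only [map_neg, hg, mul_neg]
    | add g k hg hk => simp only [map_add, hg, hk, mul_add]
    | of g => rw [MapGroup.comp_of, MapGroup.aug_of, MapGroup.aug_of, MapGroup.aug_of, mul_one]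

end

variable (𝓕 : FinSubgroupFamily G)

instance : SmallCategory (OrbitCat 𝓕) where
  Hom A B := MapGroup G (G ⧸ A.H) (G ⧸ B.H)
  id _ := FreeAbelianGroup.of (MulActionHom.id G)
  comp f g := MapGroup.comp f g
  id_comp f := MapGroup.id_comp f
  comp_id f := MapGroup.comp_id f
  assoc f g h := MapGroup.assoc f g h

instance (A B : OrbitCat 𝓕) : AddCommGroup (A ⟶ B) :=
  inferInstanceAs (AddCommGroup (MapGroup G (G ⧸ A.H) (G ⧸ B.H)))

instance : Preadditive (OrbitCat 𝓕) where
  add_comp _ _ _ f f' g := by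
    change MapGroup.comp (f + f') g = _
    rw [map_add]; rfl
  comp_add _ _ _ f g g' := map_add (MapGroup.comp f) g g'

/-- The sum of the coefficients of a morphism of the orbit category. -/
def orbitAug (A B : OrbitCat 𝓕) : (A ⟶ B) →+ ℤ :=
  (MapGroup.aug : MapGroup G (G ⧸ A.H) (G ⧸ B.H) →+ ℤ)

theorem orbitAug_id (A : OrbitCat 𝓕) : orbitAug 𝓕 A A (𝟙 A) = 1 :=
  MapGroup.aug_of _

theorem orbitAug_comp {A B C : OrbitCat 𝓕} (f : A ⟶ B) (g : B ⟶ C) :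
    orbitAug 𝓕 A C (f ≫ g) = orbitAug 𝓕 A B f * orbitAug 𝓕 B C g :=
  MapGroup.aug_comp f g

variable (R : Type v) [CommRing R]

/-- The constant Bredon module: every object goes to `R` and every `G`-map to the identity. -/
def constantModule : CatModule R (OrbitCat 𝓕) where
  obj :=
    { obj := fun _ => ModuleCat.of R (ULift.{u} R)
      map := fun {A B} f => orbitAug 𝓕 B.unop A.unop f.unop • 𝟙 _
      map_id := fun A => by rw [unop_id, orbitAug_id, one_smul]
      map_comp := fun f g => by
        rw [unop_comp, orbitAug_comp, Preadditive.zsmul_comp, Category.id_comp, smul_smul,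
          mul_comm] }
  property := ⟨fun {A B f g} => by
    dsimp only
    rw [unop_add, map_add, add_smul]⟩

/-- `G` is of type `O_𝓕-FP_n` over `R`: the constant Bredon module is of type `FP_n`. -/
def IsBredonFP (n : ℕ) : Prop := (constantModule 𝓕 R).IsFP n

end Orbit

end

/-! Type `FP_0` is finite generation: a finitely generated free cover always continues to a
projective resolution, because kernels are covered by free modules and no finiteness is asked in
positive degrees (`isFP_zero_iff_isFG`). By Yoneda, a contravariant module is finitely generated
when finitely many elements, at orbits `G/K i`, have translates spanning its value at every object
(`isFG_iff`). Both conditions are then compared with finiteness of the set of conjugacy classes.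

Suppose finitely many elements generate. It is enough that each `G/H` maps to some `G/K i`: then `H`
is subconjugate to one of finitely many finite groups, which leaves finitely many classes
(`finite_classSet_of_hom`). If `G/H` maps to none of them, the orbit category has only zero
morphisms there, so the translates span `0`, whereas the constant module has the nonzero value `R`.
In the Mackey category such morphisms can be nonzero. Instead one reads off the coefficient of the
span `G/H ⟵ G/H ⟶ G/G` with identity left leg: it vanishes on everything factoring through the `G/K
i` (`coeff_idSpan_comp`), but equals `1` on that span itself.

Conversely, one generator per conjugacy class suffices: the element `1` of `R` for the constant
module, and the span with identity left leg for the Burnside functor, since every basic span to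
`G/G` factors through such a span (`exists_comp_idSpan`). -/

noncomputable section

/-! ### Finite generation in terms of elements -/

namespace CatModule

variable {R : Type v} [CommRing R] {C : Type u} [SmallCategory C] [Preadditive C]

/-- The action of morphisms on an element, as an additive map in the morphism. -/
def act (M : CatModule R C) {x : C} (m : M.obj.obj (op x)) (y : C) :
    (y ⟶ x) →+ M.obj.obj (op y) :=
  AddMonoidHom.mk' (fun f => (M.obj.map f.op).hom m) fun f g => by
    have := M.property
    rw [op_add, Functor.map_add]; rfl

/-- The map `R[y, x] ⟶ M y` given by an element of `M x`. -/
def evalAt (M : CatModule R C) {x : C} (m : M.obj.obj (op x)) (y : C) :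
    R ⊗[ℤ] (y ⟶ x) →ₗ[R] M.obj.obj (op y) :=
  TensorProduct.AlgebraTensorModule.lift
    { toFun := fun r => r • (M.act m y).toIntLinearMap
      map_add' := fun r s => add_smul r s _
      map_smul' := fun r s => mul_smul r s _ }

theorem evalAt_tmul (M : CatModule R C) {x : C} (m : M.obj.obj (op x)) (y : C) (r : R)
    (f : y ⟶ x) : M.evalAt m y (r ⊗ₜ f) = r • (M.obj.map f.op).hom m := rfl

/-- The morphism out of a free module with prescribed values on the generators. -/
def freeDesc (M : CatModule R C) {I : Type (max u v)} (x : I → C)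
    (m : ∀ i, M.obj.obj (op (x i))) : CatModule.free R x ⟶ M where
  hom :=
    { app := fun y => ModuleCat.ofHom (by
        classical exact DirectSum.toModule R I _ fun i => M.evalAt (m i) y.unop)
      naturality := fun y z f => by
        classical
        ext1
        -- Linear maps out of the free module are determined on the elements `1 ⊗ a` of each
        -- summand; there naturality is functoriality of `M` on `f.unop ≫ a`.
        refine DirectSum.linearMap_ext R fun i => ?_
        refine TensorProduct.AlgebraTensorModule.curry_injective ?_
        ext a
        change DirectSum.toModule R I _ (fun i => M.evalAt (m i) z.unop)
            (DirectSum.lmap (fun j => LinearMap.baseChange R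
              (Preadditive.leftComp (x j) f.unop).toIntLinearMap)
              (DirectSum.lof R I (fun j => R ⊗[ℤ] (y.unop ⟶ x j)) i ((1 : R) ⊗ₜ[ℤ] a)))
          = (M.obj.map f).hom (DirectSum.toModule R I _ (fun i => M.evalAt (m i) y.unop)
            (DirectSum.lof R I (fun j => R ⊗[ℤ] (y.unop ⟶ x j)) i ((1 : R) ⊗ₜ[ℤ] a)))
        rw [DirectSum.lmap_lof, DirectSum.toModule_lof, DirectSum.toModule_lof,
          LinearMap.baseChange_tmul, evalAt_tmul, evalAt_tmul, one_smul, one_smul]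
        change (M.obj.map (f.unop ≫ a).op).hom _ = _
        rw [op_comp, Functor.map_comp]; rfl }

/-- The translates at `y` of a family of elements of `M`. -/
def translates (M : CatModule R C) {I : Type*} (x : I → C)
    (m : ∀ i, M.obj.obj (op (x i))) (y : C) : Set (M.obj.obj (op y)) :=
  {t | ∃ (i : I) (f : y ⟶ x i), t = (M.obj.map f.op).hom (m i)}

theorem freeDesc_surjective (M : CatModule R C) {I : Type (max u v)} (x : I → C)
    (m : ∀ i, M.obj.obj (op (x i))) (y : Cᵒᵖ)
    (h : Submodule.span R (M.translates x m y.unop) = ⊤) :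
    Function.Surjective ((M.freeDesc x m).hom.app y).hom := by
  classical
  rw [← LinearMap.range_eq_top, eq_top_iff]
  refine h.ge.trans (Submodule.span_le.2 ?_)
  rintro _ ⟨i, f, rfl⟩
  refine ⟨DirectSum.lof R I (fun i => R ⊗[ℤ] (y.unop ⟶ x i)) i ((1 : R) ⊗ₜ[ℤ] f), ?_⟩
  refine (DirectSum.toModule_lof R i _).trans ?_
  rw [evalAt_tmul, one_smul]

/-- A morphism out of a free module has values in the span of the translates of the images of the
generators. -/
theorem range_le_span_translates (M : CatModule R C) {I : Type (max u v)} (x : I → C)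
    (f : CatModule.free R x ⟶ M) : ∃ m : ∀ i, M.obj.obj (op (x i)), ∀ y : C,
      LinearMap.range (f.hom.app (op y)).hom ≤ Submodule.span R (M.translates x m y) := by
  classical
  -- The universal elements `1 ⊗ 𝟙`; as in the Yoneda lemma, their images determine `f`.
  let gen : ∀ i, (CatModule.free R x).obj.obj (op (x i)) := fun i =>
    DirectSum.lof R I (fun j => R ⊗[ℤ] (x i ⟶ x j)) i ((1 : R) ⊗ₜ[ℤ] 𝟙 (x i))
  refine ⟨fun i => (f.hom.app (op (x i))).hom (gen i), fun y => ?_⟩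
  let F : (DirectSum I fun i => R ⊗[ℤ] (y ⟶ x i)) →ₗ[R] M.obj.obj (op y) :=
    (f.hom.app (op y)).hom
  rintro _ ⟨t, rfl⟩
  change F t ∈ _
  change DirectSum I fun i => R ⊗[ℤ] (y ⟶ x i) at t
  induction t using DirectSum.induction_on with
  | zero => rw [map_zero]; exact zero_mem _
  | add a b ha hb => rw [map_add]; exact add_mem ha hb
  | of i a =>
    change F (DirectSum.lof R I (fun i => R ⊗[ℤ] (y ⟶ x i)) i a) ∈ _
    induction a using TensorProduct.induction_on with
    | zero => rw [map_zero, map_zero]; exact zero_mem _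
    | add a b ha hb => rw [map_add, map_add]; exact add_mem ha hb
    | tmul r g =>
      -- A pure tensor `r ⊗ g` is `r` times the translate along `g` of the universal element, so
      -- naturality of `f` sends it to a multiple of a translate.
      have h1 : DirectSum.lof R I (fun i => R ⊗[ℤ] (y ⟶ x i)) i (r ⊗ₜ[ℤ] g)
          = r • DirectSum.lmap (fun j => LinearMap.baseChange R
              (Preadditive.leftComp (x j) g).toIntLinearMap)
              (DirectSum.lof R I (fun j => R ⊗[ℤ] (x i ⟶ x j)) i ((1 : R) ⊗ₜ[ℤ] 𝟙 (x i))) := by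
        rw [DirectSum.lmap_lof, LinearMap.baseChange_tmul, ← map_smul, TensorProduct.smul_tmul',
          smul_eq_mul, mul_one]
        congr 2
        exact (Category.comp_id g).symm
      rw [h1, map_smul]
      refine Submodule.smul_mem _ _ (Submodule.subset_span ⟨i, g, ?_⟩)
      exact NatTrans.naturality_apply f.hom g.op (gen i)

theorem isFG_iff (M : CatModule R C) : M.IsFG ↔ ∃ (I : Type (max u v)) (_ : Finite I) (x : I → C)
    (m : ∀ i, M.obj.obj (op (x i))), ∀ y, Submodule.span R (M.translates x m y) = ⊤ := by
  constructor
  · rintro ⟨I, hI, x, f, hf⟩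
    obtain ⟨m, hm⟩ := M.range_le_span_translates x f
    refine ⟨I, hI, x, m, fun y => eq_top_iff.2 ?_⟩
    rw [← LinearMap.range_eq_top.2 (hf (op y))]
    exact hm y
  · rintro ⟨I, hI, x, m, h⟩
    exact ⟨I, hI, x, M.freeDesc x m, fun y => M.freeDesc_surjective x m y (h y.unop)⟩

/-! ### Free covers, resolutions and type `FP_0` -/

theorem isProj_free {I : Type (max u v)} (x : I → C) : (CatModule.free R x).IsProj :=
  ⟨I, x, ⟨Retract.refl _⟩⟩

theorem exists_free_surjective (M : CatModule R C) :
    ∃ (P : CatModule R C) (f : P ⟶ M), P.IsProj ∧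
      ∀ y, Function.Surjective (f.hom.app y).hom := by
  -- Every element of every value serves as a generator; each is its own translate along the
  -- identity.
  let x : (Σ y : C, M.obj.obj (op y)) → C := Sigma.fst
  refine ⟨CatModule.free R x, M.freeDesc x Sigma.snd, isProj_free x, fun y => ?_⟩
  refine M.freeDesc_surjective x Sigma.snd y (eq_top_iff.2 fun t _ => Submodule.subset_span ?_)
  refine ⟨⟨y.unop, t⟩, 𝟙 _, ?_⟩
  change t = (M.obj.map (𝟙 y)).hom t
  rw [CategoryTheory.Functor.map_id]; rfl

/-- The kernel of a morphism, evaluated at each object. -/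
def ker {M N : CatModule R C} (f : M ⟶ N) : CatModule R C where
  obj :=
    { obj := fun y => ModuleCat.of R (LinearMap.ker (f.hom.app y).hom)
      map := fun {y z} g => ModuleCat.ofHom ((M.obj.map g).hom.restrict fun t ht => by
        rw [LinearMap.mem_ker] at ht ⊢
        exact (NatTrans.naturality_apply f.hom g t).trans (by erw [ht, map_zero]))
      map_id := fun y => by
        ext t
        change ((M.obj.map (𝟙 y)).hom t.1) = t.1
        rw [CategoryTheory.Functor.map_id]; rfl
      map_comp := fun g h => by
        ext t
        change ((M.obj.map (g ≫ h)).hom t.1) = (M.obj.map h).hom ((M.obj.map g).hom t.1)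
        rw [Functor.map_comp]; rfl }
  property := ⟨fun {y z g h} => by
    have := M.property
    ext t
    change ((M.obj.map (g + h)).hom t.1) = (M.obj.map g).hom t.1 + (M.obj.map h).hom t.1
    rw [Functor.map_add]; rfl⟩

/-- The inclusion of the kernel. -/
def kerι {M N : CatModule R C} (f : M ⟶ N) : ker f ⟶ M where
  hom :=
    { app := fun y => ModuleCat.ofHom (LinearMap.ker (f.hom.app y).hom).subtype
      naturality := fun _ _ _ => rfl }

/-- A free cover of the kernel, followed by its inclusion, has image exactly the kernel. This is the
step iterated to build resolutions. -/
theorem exists_proj_exact {M N : CatModule R C} (f : M ⟶ N) :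
    ∃ (P : CatModule R C) (d : P ⟶ M), P.IsProj ∧
      ∀ y, Function.Exact (d.hom.app y).hom (f.hom.app y).hom := by
  obtain ⟨P, g, hP, hg⟩ := exists_free_surjective (ker f)
  refine ⟨P, g ≫ kerι f, hP, fun y t => ⟨fun ht => ?_, ?_⟩⟩
  · obtain ⟨s, hs⟩ := hg y ⟨t, ht⟩
    exact ⟨s, congrArg Subtype.val hs⟩
  · rintro ⟨s, rfl⟩
    exact ((g.hom.app y).hom s).2

/-- A morphism with its source and target. -/
structure BundledHom (R : Type v) [CommRing R] (C : Type u) [SmallCategory C] [Preadditive C] where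
  {src tgt : CatModule R C}
  hom : src ⟶ tgt

/-- A projective module mapping onto the kernel of a morphism. -/
def BundledHom.next (a : BundledHom R C) : BundledHom R C where
  src := (exists_proj_exact a.hom).choose
  tgt := a.src
  hom := (exists_proj_exact a.hom).choose_spec.choose

/-- The resolution obtained by iterating `BundledHom.next`. -/
def BundledHom.seq (a : BundledHom R C) : ℕ → BundledHom R C
  | 0 => a
  | n + 1 => (a.seq n).next

/-- Finite generation passes from `P 0` to its quotient `M`; in the other direction a finite free
cover serves as `P 0`, and the remaining terms may be arbitrarily large. -/
theorem isFP_zero_iff_isFG (M : CatModule R C) : M.IsFP 0 ↔ M.IsFG := by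
  constructor
  · rintro ⟨P, d, ε, -, hε, -, -, hfg⟩
    obtain ⟨I, hI, x, f, hf⟩ := hfg 0 le_rfl
    exact ⟨I, hI, x, f ≫ ε, fun y => (hε y).comp (hf y)⟩
  · rintro ⟨I, hI, x, f, hf⟩
    -- Bundling source and target lets the resolution be defined by plain recursion. The sequence
    -- starts with the augmentation `f`, so the source of its `i`-th term is `P i` and the
    -- differential `d i` is term `i + 1`.
    let a : BundledHom R C := ⟨f⟩
    refine ⟨fun i => (a.seq i).src, fun i => (a.seq i).next.hom, f, ?_, hf, ?_, ?_, ?_⟩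
    · rintro (_ | i)
      · exact isProj_free x
      · exact (exists_proj_exact (a.seq i).hom).choose_spec.choose_spec.1
    · exact (exists_proj_exact f).choose_spec.choose_spec.2
    · exact fun i => (exists_proj_exact (a.seq (i + 1)).hom).choose_spec.choose_spec.2
    · rintro i hi
      obtain rfl := Nat.le_zero.1 hi
      exact ⟨I, hI, x, 𝟙 _, fun y t => ⟨t, rfl⟩⟩

end CatModule

/-! ### Maps between orbits and subconjugacy -/

section Classes

variable {G : Type u} [Group G] (𝓕 : FinSubgroupFamily G)

/-- A `G`-map `G/H ⟶ G/K` conjugates `H` into `K`. -/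
theorem exists_map_conj_le {H K : Subgroup G} (f : (G ⧸ H) →[G] (G ⧸ K)) :
    ∃ g : G, H.map (MulAut.conj g).toMonoidHom ≤ K := by
  obtain ⟨g, hg⟩ := QuotientGroup.mk_surjective (f ((1 : G) : G ⧸ H))
  -- If the trivial coset goes to `gK`, then every `h` in `H` fixes `gK`, that is `g⁻¹ * h * g ∈ K`.
  refine ⟨g⁻¹, ?_⟩
  rintro _ ⟨h, hh, rfl⟩
  have h1 : h • f ((1 : G) : G ⧸ H) = f ((1 : G) : G ⧸ H) := by
    rw [← map_smul]
    congr 1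
    rw [← MulAction.mem_stabilizer_iff, MulAction.stabilizer_quotient]
    exact hh
  rw [← hg] at h1
  have h2 := QuotientGroup.eq.1 h1.symm
  simpa [mul_assoc] using h2

theorem nonempty_hom_of_le_map_conj {H K : Subgroup G} (g : G)
    (h : H ≤ K.map (MulAut.conj g).toMonoidHom) : Nonempty ((G ⧸ H) →[G] (G ⧸ K)) := by
  refine ⟨cosetMap H (g • ((1 : G) : G ⧸ K)) ?_⟩
  rw [stabilizer_smul_eq_map, MulAction.stabilizer_quotient]
  exact h

namespace FinSubgroupFamily

/-- There are finitely many conjugacy classes if every `G/H` maps to one of finitely many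
orbits. -/
theorem finite_classSet_of_hom {I : Type*} [Finite I] (K : I → Subgroup G)
    (hK : ∀ i, K i ∈ 𝓕.carrier)
    (h : ∀ H ∈ 𝓕.carrier, ∃ i, Nonempty ((G ⧸ H) →[G] (G ⧸ K i))) : Finite 𝓕.ClassSet := by
  -- A finite group has finitely many subgroups; this is where finiteness of the members of the
  -- family enters.
  have hfin : ∀ i, Finite {S : Subgroup G // S ≤ K i} := fun i => by
    have := 𝓕.finite _ (hK i)
    exact Finite.of_injective (fun S => S.1.subgroupOf (K i)) fun S T hST =>
      Subtype.ext (by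
        have := Subgroup.subgroupOf_inj.1 hST
        rwa [inf_eq_left.2 S.2, inf_eq_left.2 T.2] at this)
  let F : (Σ i, {S : Subgroup G // S ≤ K i}) → 𝓕.ClassSet := fun s =>
    Quotient.mk 𝓕.conjSetoid ⟨s.2.1, 𝓕.le_mem _ (hK s.1) _ s.2.2⟩
  refine Finite.of_surjective F fun c => ?_
  induction c using Quotient.inductionOn with
  | h H =>
  obtain ⟨i, ⟨f⟩⟩ := h H.1 H.2
  obtain ⟨g, hg⟩ := exists_map_conj_le f
  exact ⟨⟨i, _, hg⟩, (Quotient.sound (s := 𝓕.conjSetoid) ⟨g, rfl⟩).symm⟩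

/-- A representative of a conjugacy class. -/
def rep (c : 𝓕.ClassSet) : 𝓕.carrier := Quotient.out (s := 𝓕.conjSetoid) c

theorem exists_eq_map_rep {H : Subgroup G} (hH : H ∈ 𝓕.carrier) :
    ∃ (c : 𝓕.ClassSet) (g : G), H = (𝓕.rep c).1.map (MulAut.conj g).toMonoidHom :=
  ⟨Quotient.mk 𝓕.conjSetoid ⟨H, hH⟩, 
    Quotient.exact (s := 𝓕.conjSetoid) (Quotient.out_eq (Quotient.mk 𝓕.conjSetoid ⟨H, hH⟩))⟩

end FinSubgroupFamily

end Classes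

/-! ### The constant module over the orbit category -/

section Bredon

variable {G : Type u} [Group G] (𝓕 : FinSubgroupFamily G) (R : Type v) [CommRing R]

theorem isFG_constantModule_iff [Nontrivial R] :
    (constantModule 𝓕 R).IsFG ↔ Finite 𝓕.ClassSet := by
  rw [CatModule.isFG_iff]
  constructor
  · rintro ⟨I, hI, x, m, h⟩
    refine 𝓕.finite_classSet_of_hom (fun i => (x i).H) (fun i => (x i).mem) fun H hH => ?_
    by_contra! hne
    have h0 : Submodule.span R ((constantModule 𝓕 R).translates x m ⟨H, hH⟩) = ⊥ := by
      rw [Submodule.span_eq_bot]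
      rintro _ ⟨i, f, rfl⟩
      have := hne i
      -- The free abelian group on the empty set of `G`-maps is trivial, so every translate at `G/H`
      -- vanishes by additivity.
      have hf : f = 0 := Subsingleton.elim (α := FreeAbelianGroup ((G ⧸ H) →[G] (G ⧸ (x i).H))) _ _
      rw [hf]
      exact map_zero ((constantModule 𝓕 R).act (m i) ⟨H, hH⟩)
    let e : (constantModule 𝓕 R).obj.obj (op ⟨H, hH⟩) := (⟨1⟩ : ULift.{u} R)
    have h1 : e ∈ Submodule.span R ((constantModule 𝓕 R).translates x m ⟨H, hH⟩) := by
      rw [h]; trivial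
    rw [h0] at h1
    exact one_ne_zero (congrArg ULift.down ((Submodule.mem_bot R).1 h1 : e = 0))
  · intro hfin
    -- One generator per class; the lift only moves the index set to the universe required of
    -- generators.
    let x : ULift.{v} 𝓕.ClassSet → OrbitCat 𝓕 := fun c => ⟨(𝓕.rep c.down).1, (𝓕.rep c.down).2⟩
    refine ⟨ULift.{v} 𝓕.ClassSet, inferInstance, x, fun _ => (⟨1⟩ : ULift.{u} R),
      fun y => eq_top_iff.2 ?_⟩
    rintro (⟨t⟩ : ULift.{u} R) -
    obtain ⟨c, g, hg⟩ := 𝓕.exists_eq_map_rep y.mem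
    obtain ⟨f⟩ := nonempty_hom_of_le_map_conj g hg.le
    -- A single `G`-map has coefficient sum `1`, so it carries the generator `1` to `1`.
    let φ : y ⟶ x ⟨c⟩ := FreeAbelianGroup.of f
    have h1 : (⟨1⟩ : ULift.{u} R) ∈ (constantModule 𝓕 R).translates x
        (fun _ => (⟨1⟩ : ULift.{u} R)) y := by
      refine ⟨⟨c⟩, φ, ?_⟩
      have hφ : orbitAug 𝓕 _ _ φ = 1 := MapGroup.aug_of f
      change _ = (ModuleCat.Hom.hom (orbitAug 𝓕 _ _ φ • 𝟙 (ModuleCat.of R (ULift.{u} R)))) _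
      rw [hφ, one_smul]; rfl
    have h2 := Submodule.smul_mem _ t (Submodule.subset_span (R := R) h1)
    have h3 : t • (⟨1⟩ : ULift.{u} R) = ⟨t⟩ := ULift.ext _ _ (mul_one t)
    exact h3 ▸ h2

end Bredon

/-! ### The Burnside functor over the Mackey category -/

section Mackey

variable {G : Type u} [Group G] (𝓕 : FinSubgroupFamily G) (R : Type v) [CommRing R]

/-- The basic morphism `G/H ⟵ G/H ⟶ G/G` with identity left leg. -/
def idSpan (H : Subgroup G) (hH : H ∈ 𝓕.carrier) : BasicSpan 𝓕 (G ⧸ H) (G ⧸ (⊤ : Subgroup G)) :=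
  SpanDiagram.cls ⟨H, hH, MulActionHom.id G,
    cosetMap H ((1 : G) : G ⧸ (⊤ : Subgroup G)) (by
      rw [MulAction.stabilizer_quotient]; exact le_top)⟩

/-- Morphisms to `G/G` are equal. -/
theorem hom_top_ext {X : Type u} [MulAction G X] (f g : X →[G] (G ⧸ (⊤ : Subgroup G))) : f = g := by
  ext x
  have := QuotientGroup.subsingleton_quotient_top (G := G)
  exact Subsingleton.elim _ _

/-- If `G/H` does not map to `Y`, then the coefficient of `idSpan` vanishes on composites through
`Y`. -/
theorem coeff_idSpan_comp {Y : Type u} [MulAction G Y] (H : Subgroup G) (hH : H ∈ 𝓕.carrier)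
    [DecidableEq (BasicSpan 𝓕 (G ⧸ H) (G ⧸ (⊤ : Subgroup G)))]
    (hY : IsEmpty ((G ⧸ H) →[G] Y)) (a : SpanGroup 𝓕 (G ⧸ H) Y)
    (b : SpanGroup 𝓕 Y (G ⧸ (⊤ : Subgroup G))) :
    FreeAbelianGroup.lift (fun s => if s = idSpan 𝓕 H hH then (1 : ℤ) else 0)
      (SpanGroup.comp 𝓕 a b) = 0 := by
  induction a using FreeAbelianGroup.induction_on with
  | zero => simp only [map_zero, AddMonoidHom.zero_apply]
  | neg f hf => simp only [map_neg, AddMonoidHom.neg_apply, hf, neg_zero]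
  | add f k hf hk => simp only [map_add, AddMonoidHom.add_apply, hf, hk, add_zero]
  | of a =>
    induction b using FreeAbelianGroup.induction_on with
    | zero => simp only [map_zero]
    | neg f hf => simp only [map_neg, hf, neg_zero]
    | add f k hf hk => simp only [map_add, hf, hk, add_zero]
    | of b =>
      obtain ⟨a, rfl⟩ := a.exists_cls
      obtain ⟨b, rfl⟩ := b.exists_cls
      rw [SpanGroup.comp_of]
      -- The composite is a sum over orbits of the pullback, so it suffices that no orbit
      -- contributes `idSpan`.
      refine finsum_induction (p := fun t => FreeAbelianGroup.lift
        (fun s => if s = idSpan 𝓕 H hH then (1 : ℤ) else 0) t = 0) (map_zero _)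
        (fun s t hs ht => by rw [map_add, hs, ht, add_zero]) fun ω => ?_
      rw [FreeAbelianGroup.lift_apply_of, if_neg]
      induction ω using Quotient.inductionOn with
      | h t =>
      intro h
      obtain ⟨σ, -, -, -⟩ := Quotient.exact (s := SpanDiagram.setoid 𝓕 _ _) h.symm
      -- An orbit contributing `idSpan` would have the form `G/H`; including it in the pullback and
      -- projecting to `Y` gives a forbidden `G`-map.
      exact hY.false ((a.right.comp (Pull.fst a.right b.left)).comp
        ((cosetMap _ t le_rfl).comp σ))

/-- A basic morphism `G/H ⟵ G/L ⟶ G/G` factors through `idSpan`. -/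
theorem exists_comp_idSpan {X : Type u} [MulAction G X]
    (d : SpanDiagram 𝓕 X (G ⧸ (⊤ : Subgroup G))) (K : Subgroup G) (hK : K ∈ 𝓕.carrier) (g : G)
    (h : d.L = K.map (MulAut.conj g).toMonoidHom) :
    ∃ e : SpanGroup 𝓕 X (G ⧸ K), SpanGroup.comp 𝓕 e (FreeAbelianGroup.of (idSpan 𝓕 K hK))
      = FreeAbelianGroup.of d.cls := by
  -- The coset `gK` has stabiliser `gKg⁻¹ = L`, which yields `G/L ⟶ G/K`. Keeping the left leg of
  -- `d` and using this map as right leg gives the factor `e`.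
  have hs : MulAction.stabilizer G (g • ((1 : G) : G ⧸ K)) = d.L := by
    rw [stabilizer_smul_eq_map, MulAction.stabilizer_quotient, h]
  let τ : (G ⧸ d.L) →[G] (G ⧸ K) := cosetMap d.L (g • ((1 : G) : G ⧸ K)) hs.ge
  refine ⟨FreeAbelianGroup.of (SpanDiagram.cls ⟨d.L, d.mem, d.left, τ⟩), ?_⟩
  rw [idSpan, SpanGroup.comp_of, ← total_diagram]
  -- Pulling back along the identity left leg of `idSpan` returns `G/L`, and the right legs agree
  -- because `G/G` is a point.
  refine total_congr 𝓕 _ _ _ _ _ _ (Pull.fst _ _) ⟨?_, ?_⟩ (fun _ => rfl)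
    (fun _ => DFunLike.congr_fun (hom_top_ext (d.right.comp (Pull.fst _ _)) _) _)
  · rintro ⟨⟨a, b⟩, h⟩ ⟨⟨a', b'⟩, h'⟩ (hb : a = a')
    subst hb
    exact Subtype.ext (Prod.ext rfl (h.symm.trans h'))
  · intro c
    exact ⟨⟨(c, τ c), rfl⟩, rfl⟩

/-- Vanishing hom groups are not available as an obstruction here; the coefficient of `idSpan`,
extended to `R`, is a functional that kills all translates from orbits to which `G/H` does not map.
-/
theorem isFG_burnsideModule_iff [Nontrivial R] :
    (burnsideModule 𝓕 R).IsFG ↔ Finite 𝓕.ClassSet := by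
  classical
  rw [CatModule.isFG_iff]
  constructor
  · rintro ⟨I, hI, x, m, h⟩
    refine 𝓕.finite_classSet_of_hom (fun i => (x i).H) (fun i => (x i).mem) fun H hH => ?_
    by_contra! hne
    let ψ : SpanGroup 𝓕 (G ⧸ H) (G ⧸ (⊤ : Subgroup G)) →+ ℤ :=
      FreeAbelianGroup.lift (fun s => if s = idSpan 𝓕 H hH then (1 : ℤ) else 0)
    let φ : R ⊗[ℤ] SpanGroup 𝓕 (G ⧸ H) (G ⧸ (⊤ : Subgroup G)) →ₗ[R] R ⊗[ℤ] ℤ :=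
      LinearMap.baseChange R ψ.toIntLinearMap
    have hle : Submodule.span R ((burnsideModule 𝓕 R).translates x m ⟨H, hH⟩)
        ≤ LinearMap.ker φ := by
      refine Submodule.span_le.2 ?_
      rintro _ ⟨i, f, rfl⟩
      change φ (LinearMap.baseChange R (SpanGroup.comp 𝓕 f).toIntLinearMap (m i)) = 0
      -- A generator need not be a pure tensor, so the vanishing is checked on pure tensors and
      -- extended additively.
      generalize m i = t
      change R ⊗[ℤ] SpanGroup 𝓕 (G ⧸ (x i).H) (G ⧸ (⊤ : Subgroup G)) at t
      induction t using TensorProduct.induction_on with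
      | zero => rw [map_zero, map_zero]
      | add a b ha hb => rw [map_add, map_add, ha, hb, add_zero]
      | tmul r b =>
        have h0 : ψ (SpanGroup.comp 𝓕 f b) = 0 := coeff_idSpan_comp 𝓕 H hH (hne i) f b
        change r ⊗ₜ[ℤ] ψ (SpanGroup.comp 𝓕 f b) = 0
        rw [h0, TensorProduct.tmul_zero]
    have h1 : (1 : R) ⊗ₜ[ℤ] FreeAbelianGroup.of (idSpan 𝓕 H hH) ∈ LinearMap.ker φ := by
      refine hle ?_
      rw [h]; trivial
    have h2 : (1 : R) ⊗ₜ[ℤ] ψ (FreeAbelianGroup.of (idSpan 𝓕 H hH)) = 0 := h1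
    rw [FreeAbelianGroup.lift_apply_of, if_pos rfl] at h2
    -- Under `R ⊗ ℤ ≅ R` the vanishing of `1 ⊗ 1` becomes `1 = 0` in `R`.
    have h3 := congrArg (TensorProduct.rid ℤ R) h2
    rw [TensorProduct.rid_tmul, one_smul, map_zero] at h3
    exact one_ne_zero h3
  · intro hfin
    let x : ULift.{v} 𝓕.ClassSet → MackeyCat 𝓕 := fun c => ⟨(𝓕.rep c.down).1, (𝓕.rep c.down).2⟩
    let m : ∀ c, (burnsideModule 𝓕 R).obj.obj (op (x c)) := fun c =>
      (1 : R) ⊗ₜ[ℤ] FreeAbelianGroup.of (idSpan 𝓕 (x c).H (x c).mem)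
    refine ⟨ULift.{v} 𝓕.ClassSet, inferInstance, x, m, fun y => eq_top_iff.2 ?_⟩
    rintro (t : R ⊗[ℤ] SpanGroup 𝓕 (G ⧸ y.H) (G ⧸ (⊤ : Subgroup G))) -
    have key : ∀ (r : R) (b : SpanGroup 𝓕 (G ⧸ y.H) (G ⧸ (⊤ : Subgroup G))),
        (r ⊗ₜ[ℤ] b : R ⊗[ℤ] SpanGroup 𝓕 (G ⧸ y.H) (G ⧸ (⊤ : Subgroup G))) ∈
          (Submodule.span R ((burnsideModule 𝓕 R).translates x m y) : Submodule R
            (R ⊗[ℤ] SpanGroup 𝓕 (G ⧸ y.H) (G ⧸ (⊤ : Subgroup G)))) := by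
      intro r b
      induction b using FreeAbelianGroup.induction_on with
      | zero => rw [TensorProduct.tmul_zero]; exact zero_mem _
      | neg b hb => rw [TensorProduct.tmul_neg]; exact neg_mem hb
      | add b c hb hc => rw [TensorProduct.tmul_add]; exact add_mem hb hc
      | of b =>
        obtain ⟨d, rfl⟩ := b.exists_cls
        obtain ⟨c, g, hg⟩ := 𝓕.exists_eq_map_rep d.mem
        obtain ⟨e, he⟩ := exists_comp_idSpan 𝓕 d _ (𝓕.rep c).2 g hg
        have h1 : (1 : R) ⊗ₜ[ℤ] FreeAbelianGroup.of d.cls ∈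
            (burnsideModule 𝓕 R).translates x m y :=
          ⟨⟨c⟩, e, congrArg (fun s => (1 : R) ⊗ₜ[ℤ] s) he.symm⟩
        have h2 := Submodule.smul_mem _ r (Submodule.subset_span (R := R) h1)
        have h3 : r • ((1 : R) ⊗ₜ[ℤ] FreeAbelianGroup.of d.cls) =
            r ⊗ₜ[ℤ] FreeAbelianGroup.of d.cls := by
          rw [TensorProduct.smul_tmul', smul_eq_mul, mul_one]
        exact h3 ▸ h2
    induction t using TensorProduct.induction_on with
    | zero => exact zero_mem _
    | add a b ha hb => exact add_mem ha hb
    | tmul r b => exact key r b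

end Mackey
end

/-! ### Comparison through the finiteness of the set of classes -/

theorem mainTheorem8 {G : Type u} [Group G] (𝓕 : FinSubgroupFamily G)
    (R : Type v) [CommRing R] [Nontrivial R] :
    (IsMackeyFP 𝓕 R 0 ↔ Finite 𝓕.ClassSet) ∧
      (IsBredonFP 𝓕 R 0 ↔ IsMackeyFP 𝓕 R 0) := by
  have hM : IsMackeyFP 𝓕 R 0 ↔ Finite 𝓕.ClassSet :=
    (CatModule.isFP_zero_iff_isFG _).trans (isFG_burnsideModule_iff 𝓕 R)
  have hB : IsBredonFP 𝓕 R 0 ↔ Finite 𝓕.ClassSet :=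
    (CatModule.isFP_zero_iff_isFG _).trans (isFG_constantModule_iff 𝓕 R)
  exact ⟨hM, hB.trans hM.symm⟩
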